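/- Let $G$ be a connected (finite-dimensional, real) Lie group with Lie algebra $\mathfrak g$, exponential map $\exp$ and left Haar measure $\mu$. Let $P\subset G$ be a Lie semigroup, i.e. a closed subsemigroup containing the identity such that the semigroup generated by $\exp(L(P))$ is dense in $P$, where $L(P)=\{X\in\mathfrak g:\exp(tX)\in P\text{ for all }t\ge 0\}$. Assume that the interior of $P$ is dense in $P$ and that $PP^{-1}=P^{-1}P=G$. A $P$-space is a non-empty proper closed subset $A\subsetneq G$ with $PA\subset A$. For a $P$-space $A$ and $k\in\{1,2,\dots\}\cup\{\infty\}$, let $\mathcal K$ be a separable complex Hilbert space of dimension $k$, and let $V^{(A,k)}=\{V_x\}_{x\in P}$ be the (strongly continuous) isometric representation of $P$ on $L^2(A,\mathcal K)$ (with respect to the restriction of $\mu$ to $A$) given by \[ (V_xf)(y)=\begin{cases} f(x^{-1}y) & \text{if } x^{-1}y\in A,\\ 0 & \text{if } x^{-1}y\notin A.\end{cases} \] Let $A_1,A_2$ be $P$-spaces and let $k_1,k_2\in\{1,2,\dots\}\cup\{\infty\}$. If $V^{(A_1,k_1)}$ and $V^{(A_2,k_2)}$ are unitarily equivalent, i.e.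 there is a unitary $U:L^2(A_1,\mathcal K_1)\to L^2(A_2,\mathcal K_2)$ with $UV^{(A_1,k_1)}_x=V^{(A_2,k_2)}_xU$ for all $x\in P$, then there exists $z\in G$ such that $A_2=A_1z$. -/

import Mathlib

open MeasureTheory
open scoped Manifold ContDiff Pointwise

/-! ### Exponential map, Lie wedges and Lie semigroups -/

section LieSemigroups

/-- The left-invariant vector field determined by `X` is complete: it has an integral curve
defined on the whole of `ℝ` and starting at the identity. -/
theorem exists_integralCurve_mulInvariantVectorField
    {E : Type*} [NormedAddCommGroup E] [NormedSpace ℝ E] [FiniteDimensional ℝ E]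
    {G : Type*} [Group G] [TopologicalSpace G] [ChartedSpace E G] [LieGroup 𝓘(ℝ, E) ∞ G]
    [T2Space G] (X : GroupLieAlgebra 𝓘(ℝ, E) G) :
    ∃ γ : ℝ → G, γ 0 = 1 ∧ IsMIntegralCurve (I := 𝓘(ℝ, E)) γ (mulInvariantVectorField X) := by
  have h3' : minSmoothness ℝ 3 ≤ (∞ : WithTop ℕ∞) := by
    rw [minSmoothness_of_isRCLikeNormedField]
    exact WithTop.coe_le_coe.2 (le_top : (3 : ℕ∞) ≤ ⊤)
  have h3 : LieGroup 𝓘(ℝ, E) (minSmoothness ℝ 3) G := LieGroup.of_le h3'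
  have h2 : IsManifold 𝓘(ℝ, E) 1 G := IsManifold.of_le (n := ∞) (by simp)
  have hv := (contMDiff_mulInvariantVectorField (I := 𝓘(ℝ, E)) (G := G) X).of_le
    (m := 1) (by simp)
  obtain ⟨γ, h0, hγ⟩ := exists_isMIntegralCurveAt_of_contMDiffAt_boundaryless
    (t₀ := 0) (x₀ := (1 : G)) hv.contMDiffAt
  obtain ⟨ε, hε, hγ⟩ := isMIntegralCurveAt_iff'.1 hγ
  rw [Real.ball_eq_Ioo, zero_sub, zero_add] at hγ
  refine exists_isMIntegralCurve_of_isMIntegralCurveOn hv hε (fun x => ?_) 1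
  refine ⟨fun t => x * γ t, by simp [h0], fun t ht => ?_⟩
  have hn : (∞ : WithTop ℕ∞) ≠ 0 := by simp
  have hd : ∀ g h : G, MDifferentiableAt 𝓘(ℝ, E) 𝓘(ℝ, E) (g * ·) h := fun g h =>
    (contMDiff_mul_left (I := 𝓘(ℝ, E)) (n := ∞)).contMDiffAt.mdifferentiableAt hn
  have key := (hd x (γ t)).hasMFDerivAt.comp_hasMFDerivWithinAt t (hγ t ht)
  let L : E →L[ℝ] E := mfderiv 𝓘(ℝ, E) 𝓘(ℝ, E) (x * ·) (γ t)
  let M : E →L[ℝ] E := mfderiv 𝓘(ℝ, E) 𝓘(ℝ, E) (γ t * ·) (1 : G)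
  have hL : ∀ h : G, h = γ t → HasMFDerivAt 𝓘(ℝ, E) 𝓘(ℝ, E) (x * ·) h L := by
    rintro _ rfl
    exact (hd x _).hasMFDerivAt
  have hM : HasMFDerivAt 𝓘(ℝ, E) 𝓘(ℝ, E) (γ t * ·) (1 : G) M := (hd (γ t) 1).hasMFDerivAt
  have hLM : HasMFDerivAt 𝓘(ℝ, E) 𝓘(ℝ, E) (x * γ t * ·) (1 : G) (L.comp M) := by
    have := (hL (γ t * 1) (mul_one _)).comp (1 : G) hM
    refine this.congr_of_eventuallyEq (.of_forall fun z => ?_)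
    simp [mul_assoc]
  have hLM' : (mfderiv 𝓘(ℝ, E) 𝓘(ℝ, E) (x * γ t * ·) (1 : G) : E →L[ℝ] E) = L.comp M :=
    hLM.mfderiv
  have hv' : (mulInvariantVectorField X (x * γ t) : E) = L (mulInvariantVectorField X (γ t)) :=
    congrArg (fun T : E →L[ℝ] E => T X) hLM'
  have hs : (1 : ℝ →L[ℝ] ℝ).smulRight (mulInvariantVectorField X (x * γ t) : E) =
      L.comp ((1 : ℝ →L[ℝ] ℝ).smulRight (mulInvariantVectorField X (γ t) : E)) := by
    rw [hv']
    exact ContinuousLinearMap.ext fun r => (L.map_smul _ _).symm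
  exact hs ▸ key

/-- The exponential map of a Lie group: `lieExp X = γ 1`, where `γ` is the integral curve of the
left-invariant vector field determined by `X` with `γ 0 = 1`. -/
noncomputable def lieExp
    {E : Type*} [NormedAddCommGroup E] [NormedSpace ℝ E] [FiniteDimensional ℝ E]
    {G : Type*} [Group G] [TopologicalSpace G] [ChartedSpace E G] [LieGroup 𝓘(ℝ, E) ∞ G]
    [T2Space G] (X : GroupLieAlgebra 𝓘(ℝ, E) G) : G :=
  (exists_integralCurve_mulInvariantVectorField X).choose 1

/-- The Lie wedge `L(P) = {X : exp (t X) ∈ P for all t ≥ 0}` of a subsemigroup `P` containing the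
identity. -/
def lieWedge
    (E : Type*) [NormedAddCommGroup E] [NormedSpace ℝ E] [FiniteDimensional ℝ E]
    {G : Type*} [Group G] [TopologicalSpace G] [ChartedSpace E G] [LieGroup 𝓘(ℝ, E) ∞ G]
    [T2Space G] (P : Submonoid G) : Set (GroupLieAlgebra 𝓘(ℝ, E) G) :=
  {X | ∀ t : ℝ, 0 ≤ t → lieExp (t • X) ∈ P}

/-- A closed subsemigroup `P` containing the identity is a Lie semigroup if the semigroup
generated by `exp (L(P))` is dense in `P`. -/
structure IsLieSemigroup
    (E : Type*) [NormedAddCommGroup E] [NormedSpace ℝ E] [FiniteDimensional ℝ E]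
    {G : Type*} [Group G] [TopologicalSpace G] [ChartedSpace E G] [LieGroup 𝓘(ℝ, E) ∞ G]
    [T2Space G] (P : Submonoid G) : Prop where
  isClosed : IsClosed (P : Set G)
  dense_generated :
    (P : Set G) ⊆ closure (Subsemigroup.closure (lieExp '' lieWedge E P) : Set G)

end LieSemigroups

/-! ### Isometric representations and unitary equivalence -/

section IsometricRepresentations

/-- An isometric representation of `P` on `H`: a strongly continuous semigroup of isometries. -/
structure IsometricRep {G : Type*} [Group G] [TopologicalSpace G] (P : Submonoid G)
    (H : Type*) [NormedAddCommGroup H] [InnerProductSpace ℂ H] where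
  toFun : P → (H →ₗᵢ[ℂ] H)
  map_mul : ∀ x y : P, toFun (x * y) = (toFun x).comp (toFun y)
  strongly_continuous : ∀ ξ : H, Continuous fun x : P => toFun x ξ

/-- Unitary equivalence of isometric representations: there is a unitary `U` with
`U V_x = W_x U` for all `x ∈ P`. -/
def IsometricRep.UnitarilyEquivalent {G : Type*} [Group G] [TopologicalSpace G] {P : Submonoid G}
    {H₁ : Type*} [NormedAddCommGroup H₁] [InnerProductSpace ℂ H₁]
    {H₂ : Type*} [NormedAddCommGroup H₂] [InnerProductSpace ℂ H₂]
    (V : IsometricRep P H₁) (W : IsometricRep P H₂) : Prop :=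
  ∃ U : H₁ ≃ₗᵢ[ℂ] H₂, ∀ (x : P) (ξ : H₁), U (V.toFun x ξ) = W.toFun x (U ξ)

end IsometricRepresentations

/-! ### `P`-spaces and their isometric representations -/

section PSpaces

/-- A `P`-space: a non-empty proper closed subset `A` of `G` with `P A ⊆ A`. -/
structure IsPSpace {G : Type*} [Group G] [TopologicalSpace G] (P : Submonoid G) (A : Set G) :
    Prop where
  nonempty : A.Nonempty
  ne_univ : A ≠ Set.univ
  isClosed : IsClosed A
  mul_mem : ∀ a ∈ P, ∀ x ∈ A, a * x ∈ A

open scoped Classical in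
/-- The function `y ↦ f (x⁻¹ y)` if `x⁻¹ y ∈ A`, and `y ↦ 0` if `x⁻¹ y ∉ A`. -/
noncomputable def shiftFun {G : Type*} [Group G] {K : Type*} [Zero K] (A : Set G) (x : G)
    (f : G → K) (y : G) : K :=
  if x⁻¹ * y ∈ A then f (x⁻¹ * y) else 0

theorem shiftFun_eq_comp {G : Type*} [Group G] {K : Type*} [Zero K] (A : Set G) (x : G)
    (f : G → K) : shiftFun A x f = A.indicator f ∘ (x⁻¹ * ·) := by
  ext y
  by_cases h : x⁻¹ * y ∈ A <;> simp [shiftFun, h]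

theorem shiftFun_ae_congr {G : Type*} [Group G] [TopologicalSpace G] [IsTopologicalGroup G]
    [MeasurableSpace G] [BorelSpace G] {μ : Measure G} [μ.IsMulLeftInvariant]
    {K : Type*} [Zero K] {A : Set G} (hA : MeasurableSet A) (x : G) {f g : G → K}
    (h : f =ᵐ[μ.restrict A] g) : shiftFun A x f =ᵐ[μ] shiftFun A x g := by
  rw [shiftFun_eq_comp, shiftFun_eq_comp]
  exact (measurePreserving_mul_left μ x⁻¹).quasiMeasurePreserving.ae_eq_comp
    (by
      filter_upwards [(ae_restrict_iff' hA).1 h] with y hy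
      by_cases hyA : y ∈ A <;> simp [hyA, hy])

theorem shiftFun_eq_indicator {G : Type*} [Group G] {K : Type*} [Zero K] {A : Set G} {x : G}
    (hx : ∀ y ∈ A, x * y ∈ A) (f : G → K) : A.indicator (shiftFun A x f) = shiftFun A x f := by
  refine Set.indicator_eq_self.2 fun y hy => ?_
  by_contra hyA
  refine hy ?_
  have : x⁻¹ * y ∉ A := fun h => hyA (by simpa using hx _ h)
  simp [shiftFun, this]

theorem eLpNorm_shiftFun {G : Type*} [Group G] [TopologicalSpace G] [IsTopologicalGroup G]
    [MeasurableSpace G] [BorelSpace G] {μ : Measure G} [μ.IsMulLeftInvariant]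
    {K : Type*} [NormedAddCommGroup K] {A : Set G} (hA : MeasurableSet A) {x : G}
    (hx : ∀ y ∈ A, x * y ∈ A) {f : G → K} (hf : AEStronglyMeasurable f (μ.restrict A)) :
    eLpNorm (shiftFun A x f) 2 (μ.restrict A) = eLpNorm f 2 (μ.restrict A) := by
  rw [← eLpNorm_indicator_eq_eLpNorm_restrict hA, shiftFun_eq_indicator hx, shiftFun_eq_comp,
    eLpNorm_comp_measurePreserving ((aestronglyMeasurable_indicator_iff hA).2 hf)
      (measurePreserving_mul_left μ x⁻¹), eLpNorm_indicator_eq_eLpNorm_restrict hA]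

theorem memLp_shiftFun {G : Type*} [Group G] [TopologicalSpace G] [IsTopologicalGroup G]
    [MeasurableSpace G] [BorelSpace G] {μ : Measure G} [μ.IsMulLeftInvariant]
    {K : Type*} [NormedAddCommGroup K] {A : Set G} (hA : MeasurableSet A) {x : G}
    (hx : ∀ y ∈ A, x * y ∈ A) {f : G → K} (hf : MemLp f 2 (μ.restrict A)) :
    MemLp (shiftFun A x f) 2 (μ.restrict A) := by
  refine ⟨?_, by rw [eLpNorm_shiftFun hA hx hf.1]; exact hf.2⟩
  rw [shiftFun_eq_comp]
  exact (((aestronglyMeasurable_indicator_iff hA).2 hf.1).comp_measurePreserving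
    (measurePreserving_mul_left μ x⁻¹)).restrict

/-- The isometry `V_x` of `L²(A, K)` with `(V_x f)(y) = f (x⁻¹ y)` if `x⁻¹ y ∈ A` and
`(V_x f)(y) = 0` otherwise. -/
noncomputable def shiftIsometry {G : Type*} [Group G] [TopologicalSpace G] [IsTopologicalGroup G]
    [MeasurableSpace G] [BorelSpace G] (μ : Measure G) [μ.IsMulLeftInvariant]
    (K : Type*) [NormedAddCommGroup K] [InnerProductSpace ℂ K] {A : Set G} (hA : MeasurableSet A)
    {x : G} (hx : ∀ y ∈ A, x * y ∈ A) :
    Lp K 2 (μ.restrict A) →ₗᵢ[ℂ] Lp K 2 (μ.restrict A) where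
  toFun f := (memLp_shiftFun hA hx (Lp.memLp f)).toLp (shiftFun A x f)
  map_add' f g := by
    rw [← MemLp.toLp_add]
    refine MemLp.toLp_congr _ _ (ae_restrict_of_ae ?_)
    refine (shiftFun_ae_congr hA x (Lp.coeFn_add f g)).trans (.of_forall fun y => ?_)
    simp only [shiftFun, Pi.add_apply]
    split_ifs <;> simp
  map_smul' c f := by
    rw [RingHom.id_apply, ← MemLp.toLp_const_smul]
    refine MemLp.toLp_congr _ _ (ae_restrict_of_ae ?_)
    refine (shiftFun_ae_congr hA x (Lp.coeFn_smul c f)).trans (.of_forall fun y => ?_)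
    simp only [shiftFun, Pi.smul_apply]
    split_ifs <;> simp
  norm_map' f := by
    simp only [LinearMap.coe_mk, AddHom.coe_mk, Lp.norm_toLp]
    rw [eLpNorm_shiftFun hA hx (Lp.aestronglyMeasurable f), Lp.norm_def]

theorem shiftIsometry_coeFn {G : Type*} [Group G] [TopologicalSpace G] [IsTopologicalGroup G]
    [MeasurableSpace G] [BorelSpace G] (μ : Measure G) [μ.IsMulLeftInvariant]
    (K : Type*) [NormedAddCommGroup K] [InnerProductSpace ℂ K] {A : Set G} (hA : MeasurableSet A)
    {x : G} (hx : ∀ y ∈ A, x * y ∈ A) (f : Lp K 2 (μ.restrict A)) :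
    shiftIsometry μ K hA hx f =ᵐ[μ.restrict A] shiftFun A x f :=
  MemLp.coeFn_toLp (memLp_shiftFun hA hx (Lp.memLp f))

/-- The isometric representation `V^{(A, K)}` of `P` on `L²(A, K)` associated to the `P`-space
`A`, with multiplicity the Hilbert space `K`; here `L²(A, K)` is formed with respect to the
restriction to `A` of the left Haar measure `μ`. -/
noncomputable def pSpaceRep {G : Type*} [Group G] [TopologicalSpace G] [IsTopologicalGroup G]
    [LocallyCompactSpace G] [MeasurableSpace G] [BorelSpace G] (μ : Measure G) [μ.IsHaarMeasure] [μ.Regular]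
    (K : Type*) [NormedAddCommGroup K] [InnerProductSpace ℂ K]
    {P : Submonoid G} {A : Set G} (hA : IsPSpace P A) :
    IsometricRep P (Lp K 2 (μ.restrict A)) where
  toFun x := shiftIsometry μ K hA.isClosed.measurableSet (hA.mul_mem x x.2)
  map_mul x y := by
    ext1 f
    have hm := hA.isClosed.measurableSet
    refine Lp.ext ((shiftIsometry_coeFn μ K hm _ f).trans ?_)
    change _ =ᵐ[μ.restrict A] shiftIsometry μ K hm (hA.mul_mem x x.2)
      (shiftIsometry μ K hm (hA.mul_mem y y.2) f)
    refine .trans ?_ (shiftIsometry_coeFn μ K hm (hA.mul_mem x x.2) _).symm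
    have hc : shiftFun A (x : G) (shiftIsometry μ K hm (hA.mul_mem y y.2) f) =ᵐ[μ.restrict A]
        shiftFun A (x : G) (shiftFun A (y : G) f) :=
      ae_restrict_of_ae (shiftFun_ae_congr hm x (shiftIsometry_coeFn μ K hm (hA.mul_mem y y.2) f))
    refine Filter.EventuallyEq.trans (Filter.Eventually.of_forall fun z => ?_) hc.symm
    by_cases h : (y : G)⁻¹ * ((x : G)⁻¹ * z) ∈ A
    · have h' : (x : G)⁻¹ * z ∈ A := by simpa using hA.mul_mem y y.2 _ h
      simp [shiftFun, mul_assoc, h, h']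
    · simp [shiftFun, mul_assoc, h]
  strongly_continuous f := by
    have hm := hA.isClosed.measurableSet
    have : Fact ((2 : ENNReal) ≠ ⊤) := ⟨by simp⟩
    have hF : MemLp (A.indicator f) 2 μ := (memLp_indicator_iff_restrict hm).2 (Lp.memLp f)
    have hc : Continuous fun x : P =>
        LpToLpRestrictCLM G K ℂ μ 2 A ((DomMulAct.mk ((x : G)⁻¹)) • hF.toLp _) := by
      refine (LpToLpRestrictCLM G K ℂ μ 2 A).continuous.comp ?_
      have : Continuous fun x : P => DomMulAct.mk ((x : G)⁻¹) :=
        DomMulAct.continuous_mk.comp (continuous_subtype_val.inv)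
      exact this.smul continuous_const
    convert hc using 2 with x
    refine Lp.ext ((shiftIsometry_coeFn μ K hm _ f).trans ?_)
    refine .trans ?_ (LpToLpRestrictCLM_coeFn ℂ A _).symm
    refine ae_restrict_of_ae ?_
    rw [DomMulAct.mk_smul_toLp]
    rw [shiftFun_eq_comp]
    exact (MemLp.coeFn_toLp (hF.comp_measurePreserving
      (measurePreserving_smul ((x : G)⁻¹) μ))).symm

end PSpaces

open ContinuousLinearMap

/-! On `L²(A, K)` the operator `V_x* V_y V_y* V_x` is multiplication by the indicator of `x⁻¹yA`,
and a unitary equivalence carries these operators to their counterparts. Since `P⁻¹P = G`, every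
translate `dA` arises this way. Fix a dense sequence `d n` and code a point by which `d n A` contain
it. Products of the operators compute the masses of finite intersections of translates, so the law
of the code under `‖f‖² μ` equals that under `‖U f‖² μ` (`codeMeasure_map_eq`). If no `a ∈ A₁` and
`b ∈ A₂` shared a code, the two analytic sets of codes would be separated by a Borel set, forcing
every `f` to vanish (`exists_translateCode_eq`). For such `a` and `b`, density of `d` together with
`A ⊆ closure (interior A)` gives `g a ∈ A₁ ↔ g b ∈ A₂` for all `g` (`mul_mem_of_dense_translates`),
hence `A₂ = A₁ a⁻¹b`. -/

section Auxiliary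

/-- The operator `V_x* V_y V_y* V_x` of an isometric representation. -/
noncomputable def IsometricRep.compressedRangeProj {G : Type*} [Group G] [TopologicalSpace G]
    {P : Submonoid G} {H : Type*} [NormedAddCommGroup H] [InnerProductSpace ℂ H] [CompleteSpace H]
    (V : IsometricRep P H) (x y : P) (ξ : H) : H :=
  adjoint (V.toFun x).toContinuousLinearMap (V.toFun y
    (adjoint (V.toFun y).toContinuousLinearMap (V.toFun x ξ)))

theorem LinearIsometryEquiv.map_adjoint_of_intertwines
    {H₁ : Type*} [NormedAddCommGroup H₁] [InnerProductSpace ℂ H₁] [CompleteSpace H₁]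
    {H₂ : Type*} [NormedAddCommGroup H₂] [InnerProductSpace ℂ H₂] [CompleteSpace H₂]
    (U : H₁ ≃ₗᵢ[ℂ] H₂) {S : H₁ →L[ℂ] H₁} {T : H₂ →L[ℂ] H₂} (h : ∀ ξ, U (S ξ) = T (U ξ)) (ξ : H₁) :
    U (adjoint S ξ) = adjoint T (U ξ) := by
  refine ext_inner_right ℂ fun η => ?_
  obtain ⟨η, rfl⟩ := U.surjective η
  rw [adjoint_inner_left, U.inner_map_map, adjoint_inner_left, ← h, U.inner_map_map]

theorem IsometricRep.map_compressedRangeProj {G : Type*} [Group G] [TopologicalSpace G]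
    {P : Submonoid G}
    {H₁ : Type*} [NormedAddCommGroup H₁] [InnerProductSpace ℂ H₁] [CompleteSpace H₁]
    {H₂ : Type*} [NormedAddCommGroup H₂] [InnerProductSpace ℂ H₂] [CompleteSpace H₂]
    {V : IsometricRep P H₁} {W : IsometricRep P H₂} {U : H₁ ≃ₗᵢ[ℂ] H₂}
    (hU : ∀ (x : P) (ξ : H₁), U (V.toFun x ξ) = W.toFun x (U ξ)) (x y : P) (ξ : H₁) :
    U (V.compressedRangeProj x y ξ) = W.compressedRangeProj x y (U ξ) := by
  have h : ∀ (x : P) (ξ : H₁), U (adjoint (V.toFun x).toContinuousLinearMap ξ) =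
      adjoint (W.toFun x).toContinuousLinearMap (U ξ) := fun x =>
    U.map_adjoint_of_intertwines (hU x)
  simp only [compressedRangeProj, h, hU]

/-! ### Adjoints of the shifts -/

section Shift

variable {G : Type*} [Group G] [TopologicalSpace G] [IsTopologicalGroup G]
  [MeasurableSpace G] [BorelSpace G] {μ : Measure G} [μ.IsMulLeftInvariant]
  {K : Type*} [NormedAddCommGroup K] [InnerProductSpace ℂ K] {A : Set G}

omit [InnerProductSpace ℂ K] in
theorem memLp_comp_mul_left (hA : MeasurableSet A) {x : G} (hx : ∀ y ∈ A, x * y ∈ A) {f : G → K}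
    (hf : MemLp f 2 (μ.restrict A)) : MemLp (fun z => f (x * z)) 2 (μ.restrict A) := by
  have h := (((memLp_indicator_iff_restrict hA).2 hf).comp_measurePreserving
    (measurePreserving_mul_left μ x)).restrict A
  refine h.ae_eq ((ae_restrict_iff' hA).2 (.of_forall fun z hz => ?_))
  simp [hx z hz]

/-- Left invariance and the substitution `y = x z`; no cutoff appears because `x A ⊆ A`. -/
theorem adjoint_shiftIsometry_coeFn [CompleteSpace K] (hA : MeasurableSet A) {x : G}
    (hx : ∀ y ∈ A, x * y ∈ A) (f : Lp K 2 (μ.restrict A)) :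
    adjoint (shiftIsometry μ K hA hx).toContinuousLinearMap f =ᵐ[μ.restrict A]
      fun z => f (x * z) := by
  have hm := memLp_comp_mul_left hA hx (Lp.memLp f)
  suffices h : adjoint (shiftIsometry μ K hA hx).toContinuousLinearMap f = hm.toLp _ by
    rw [h]; exact hm.coeFn_toLp
  refine ext_inner_right ℂ fun h => ?_
  rw [adjoint_inner_left, L2.inner_def, L2.inner_def]
  -- Both inner products extend to integrals over all of `G`, because the shifted function vanishes
  -- off `x A ⊆ A`; translation by `x` then identifies them.
  have h1 : ∫ y in A, inner ℂ (f y) (shiftIsometry μ K hA hx h y) ∂μ =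
      ∫ y, inner ℂ (f y) (shiftFun A x h y) ∂μ := by
    rw [← integral_indicator hA]
    refine integral_congr_ae ?_
    filter_upwards [(ae_restrict_iff' hA).1 (shiftIsometry_coeFn μ K hA hx h)] with y hy
    by_cases hyA : y ∈ A
    · simp [hyA, hy]
    · have : shiftFun A x h y = 0 := by
        rw [← shiftFun_eq_indicator hx]; simp [hyA]
      simp [hyA, this]
  have h2 : ∫ z in A, inner ℂ (hm.toLp _ z) (h z) ∂μ =
      ∫ z, inner ℂ (f (x * z)) (shiftFun A x h (x * z)) ∂μ := by
    rw [← integral_indicator hA]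
    refine integral_congr_ae ?_
    filter_upwards [(ae_restrict_iff' hA).1 hm.coeFn_toLp] with y hy
    by_cases hyA : y ∈ A
    · simp [hyA, hy, shiftFun]
    · simp [hyA, shiftFun]
  exact h1.trans ((integral_mul_left_eq_self (fun y => inner ℂ (f y) (shiftFun A x h y)) x).symm.trans
    h2.symm)

theorem ae_restrict_comp_mul_left (hA : MeasurableSet A) {x : G} (hx : ∀ y ∈ A, x * y ∈ A)
    {p : G → Prop} (hp : ∀ᵐ y ∂μ.restrict A, p y) : ∀ᵐ y ∂μ.restrict A, p (x * y) := by
  rw [ae_restrict_iff' hA] at hp ⊢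
  filter_upwards [(measurePreserving_mul_left μ x).quasiMeasurePreserving.ae hp] with y hy hyA
  exact hy (hx y hyA)

end Shift

/-! ### Indicators of translates from the representation -/

section PSpaceRep

variable {G : Type*} [Group G] [TopologicalSpace G] [IsTopologicalGroup G]
  [LocallyCompactSpace G] [MeasurableSpace G] [BorelSpace G] {μ : Measure G} [μ.IsHaarMeasure]
  [μ.Regular] {K : Type*} [NormedAddCommGroup K] [InnerProductSpace ℂ K] [CompleteSpace K]
  {P : Submonoid G} {A : Set G}

/-- `V_y V_y*` is multiplication by the indicator of `y A`, and compressing by `V_x` moves this set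
by `x⁻¹`. -/
theorem compressedRangeProj_pSpaceRep_coeFn (hA : IsPSpace P A) (x y : P)
    (f : Lp K 2 (μ.restrict A)) :
    (pSpaceRep μ K hA).compressedRangeProj x y f =ᵐ[μ.restrict A]
      {z | ((x : G)⁻¹ * y)⁻¹ * z ∈ A}.indicator f := by
  have hm := hA.isClosed.measurableSet
  have hx := hA.mul_mem x x.2
  have hy := hA.mul_mem y y.2
  set Vx := shiftIsometry μ K hm hx with hVx
  set Vy := shiftIsometry μ K hm hy with hVy
  have e1 := adjoint_shiftIsometry_coeFn hm hx (Vy (adjoint Vy.toContinuousLinearMap (Vx f)))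
  have e2 := ae_restrict_comp_mul_left hm hx
    (shiftIsometry_coeFn μ K hm hy (adjoint Vy.toContinuousLinearMap (Vx f)))
  have e3 := ae_restrict_comp_mul_left hm hx (ae_restrict_of_ae (s := A)
    (shiftFun_ae_congr hm (y : G) (adjoint_shiftIsometry_coeFn hm hy (Vx f))))
  have e4 := ae_restrict_comp_mul_left hm hx (shiftIsometry_coeFn μ K hm hx f)
  filter_upwards [e1, e2, e3, e4, ae_restrict_mem hm] with z h1 h2 h3 h4 hz
  refine h1.trans (h2.trans (h3.trans ?_))
  have hz' : shiftFun A (x : G) f (x * z) = f z := by simp [shiftFun, hz]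
  rw [hz'] at h4
  by_cases h : (y : G)⁻¹ * (x * z) ∈ A
  · simp [shiftFun, h, mul_assoc, hVx, h4]
  · simp [shiftFun, h, mul_assoc]

/-- Multiplying indicators intersects the translates, which supplies the finite intersections needed
for a π-system. -/
theorem foldr_compressedRangeProj_pSpaceRep_coeFn (hA : IsPSpace P A) {ι : Type*} (x y : ι → P)
    (l : List ι) (f : Lp K 2 (μ.restrict A)) :
    (l.foldr (fun n ξ => (pSpaceRep μ K hA).compressedRangeProj (x n) (y n) ξ) f :
      Lp K 2 (μ.restrict A)) =ᵐ[μ.restrict A]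
      {z | ∀ n ∈ l, ((x n : G)⁻¹ * y n)⁻¹ * z ∈ A}.indicator f := by
  induction l with
  | nil => simp
  | cons n l ih =>
    rw [List.foldr_cons]
    refine (compressedRangeProj_pSpaceRep_coeFn hA (x n) (y n) _).trans ?_
    have hset : {z | ∀ m ∈ n :: l, ((x m : G)⁻¹ * y m)⁻¹ * z ∈ A} =
        {z | ((x n : G)⁻¹ * y n)⁻¹ * z ∈ A} ∩ {z | ∀ m ∈ l, ((x m : G)⁻¹ * y m)⁻¹ * z ∈ A} :=
      Set.ext fun z => List.forall_mem_cons
    rw [hset, ← Set.indicator_indicator]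
    filter_upwards [ih] with z hz
    exact Set.indicator_eq_indicator Iff.rfl hz

end PSpaceRep

/-! ### Coding points by translates -/

section TranslateCode

open scoped Classical in
/-- The code of `z` records which of the translates `d n * A` contain `z`. -/
noncomputable def translateCode {G ι : Type*} [Group G] (A : Set G) (d : ι → G) (z : G) (n : ι) :
    Bool :=
  decide ((d n)⁻¹ * z ∈ A)

theorem translateCode_eq_true_iff {G ι : Type*} [Group G] {A : Set G} {d : ι → G} {z : G} {n : ι} :
    translateCode A d z n = true ↔ (d n)⁻¹ * z ∈ A := by
  simp [translateCode]

theorem measurable_translateCode {G ι : Type*} [Group G] [TopologicalSpace G]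
    [IsTopologicalGroup G] [MeasurableSpace G] [BorelSpace G] {A : Set G} (hA : MeasurableSet A)
    (d : ι → G) : Measurable (translateCode A d) := by
  refine measurable_pi_lambda _ fun n => measurable_to_bool ?_
  have : (fun z => translateCode A d z n) ⁻¹' {true} = (fun z => (d n)⁻¹ * z) ⁻¹' A := by
    ext z; simp [translateCode]
  rw [this]
  exact (continuous_const_mul _).measurable hA

/-- The sets `{w | ∀ n ∈ l, w n = true}`, for `l` a list of indices. -/
def trueCylinders (ι : Type*) : Set (Set (ι → Bool)) :=
  Set.range fun l : List ι => {w | ∀ n ∈ l, w n = true}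

theorem isPiSystem_trueCylinders (ι : Type*) : IsPiSystem (trueCylinders ι) := by
  rintro _ ⟨l, rfl⟩ _ ⟨m, rfl⟩ -
  refine ⟨l ++ m, ?_⟩
  ext w
  simp [or_imp, forall_and]

theorem measurableSet_trueCylinder {ι : Type*} (l : List ι) :
    MeasurableSet {w : ι → Bool | ∀ n ∈ l, w n = true} := by
  have : {w : ι → Bool | ∀ n ∈ l, w n = true} = ⋂ n ∈ {n | n ∈ l}, (fun w => w n) ⁻¹' {true} := by
    ext w; simp
  rw [this]
  exact MeasurableSet.biInter l.finite_toSet.countable fun n _ =>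
    measurable_pi_apply n (measurableSet_singleton true)

/-- Positive conditions suffice, since `w n = false` is the complement of one. -/
theorem generateFrom_trueCylinders (ι : Type*) :
    (MeasurableSpace.pi : MeasurableSpace (ι → Bool)) =
      MeasurableSpace.generateFrom (trueCylinders ι) := by
  refine le_antisymm (iSup_le fun n => ?_) (MeasurableSpace.generateFrom_le ?_)
  · rw [← measurable_iff_comap_le]
    refine @measurable_to_bool _ (MeasurableSpace.generateFrom (trueCylinders ι)) _
      (MeasurableSpace.measurableSet_generateFrom ⟨[n], ?_⟩)
    ext w; simp
  · rintro _ ⟨l, rfl⟩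
    exact measurableSet_trueCylinder l

end TranslateCode

/-! ### The law of the code is a unitary invariant -/

section CodeMeasure

variable {G : Type*} [Group G] [TopologicalSpace G] [IsTopologicalGroup G]
  [MeasurableSpace G] [BorelSpace G] {A : Set G} {ι : Type*}

/-- The image of the measure `‖f‖² μ|_A` under the coding map. -/
noncomputable def codeMeasure {K : Type*} [NormedAddCommGroup K] (μ : Measure G) (A : Set G)
    (d : ι → G) (f : Lp K 2 (μ.restrict A)) : Measure (ι → Bool) :=
  ((μ.restrict A).withDensity fun z => ‖f z‖ₑ ^ (2 : ℝ)).map (translateCode A d)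

theorem codeMeasure_apply {K : Type*} [NormedAddCommGroup K] {μ : Measure G}
    (hA : MeasurableSet A) (d : ι → G) (f : Lp K 2 (μ.restrict A)) {s : Set (ι → Bool)} (hs : MeasurableSet s) :
    codeMeasure μ A d f s =
      ∫⁻ z, ‖(translateCode A d ⁻¹' s).indicator f z‖ₑ ^ (2 : ℝ) ∂μ.restrict A := by
  have hm := measurable_translateCode hA d
  rw [codeMeasure, Measure.map_apply hm hs, withDensity_apply _ (hm hs),
    ← lintegral_indicator (hm hs)]
  refine lintegral_congr fun z => ?_
  by_cases h : z ∈ translateCode A d ⁻¹' s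
  · rw [Set.indicator_of_mem h, Set.indicator_of_mem h]
  · rw [Set.indicator_of_notMem h, Set.indicator_of_notMem h]; simp

theorem lintegral_enorm_rpow_two {α K : Type*} [MeasurableSpace α] [NormedAddCommGroup K]
    {ν : Measure α} (f : Lp K 2 ν) : ∫⁻ z, ‖f z‖ₑ ^ (2 : ℝ) ∂ν = ‖f‖ₑ ^ (2 : ℝ) := by
  have := eLpNorm_nnreal_pow_eq_lintegral (f := f) (μ := ν) (p := 2) two_ne_zero
  rw [Lp.enorm_def]
  simpa using this.symm

theorem codeMeasure_univ {K : Type*} [NormedAddCommGroup K] {μ : Measure G}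
    (hA : MeasurableSet A) (d : ι → G) (f : Lp K 2 (μ.restrict A)) :
    codeMeasure μ A d f Set.univ = ‖f‖ₑ ^ (2 : ℝ) := by
  rw [codeMeasure_apply hA d f .univ, ← lintegral_enorm_rpow_two]
  simp

variable [LocallyCompactSpace G] {μ : Measure G} [μ.IsHaarMeasure] [μ.Regular] {P : Submonoid G}

/-- Expresses the law of the code through norms of vectors built from the representation alone. -/
theorem codeMeasure_trueCylinder {K : Type*} [NormedAddCommGroup K] [InnerProductSpace ℂ K]
    [CompleteSpace K] (hA : IsPSpace P A) (x y : ι → P) (f : Lp K 2 (μ.restrict A)) (l : List ι) :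
    codeMeasure μ A (fun n => (x n : G)⁻¹ * y n) f {w | ∀ n ∈ l, w n = true} =
      ‖l.foldr (fun n ξ => (pSpaceRep μ K hA).compressedRangeProj (x n) (y n) ξ) f‖ₑ ^ (2 : ℝ) := by
  rw [codeMeasure_apply hA.isClosed.measurableSet _ _ (measurableSet_trueCylinder l),
    ← lintegral_enorm_rpow_two]
  refine lintegral_congr_ae ?_
  filter_upwards [foldr_compressedRangeProj_pSpaceRep_coeFn hA x y l f] with z hz
  rw [hz]
  simp only [Set.preimage_ofPred_eq, translateCode_eq_true_iff]

/-- `U` commutes with the operators and preserves norms, so the two finite measures agree on a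
generating π-system and in total mass. -/
theorem codeMeasure_map_eq
    {K₁ : Type*} [NormedAddCommGroup K₁] [InnerProductSpace ℂ K₁] [CompleteSpace K₁]
    {K₂ : Type*} [NormedAddCommGroup K₂] [InnerProductSpace ℂ K₂] [CompleteSpace K₂]
    {A₁ A₂ : Set G} (hA₁ : IsPSpace P A₁) (hA₂ : IsPSpace P A₂)
    (U : Lp K₁ 2 (μ.restrict A₁) ≃ₗᵢ[ℂ] Lp K₂ 2 (μ.restrict A₂))
    (hU : ∀ (x : P) ξ, U ((pSpaceRep μ K₁ hA₁).toFun x ξ) = (pSpaceRep μ K₂ hA₂).toFun x (U ξ))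
    (x y : ι → P) (f : Lp K₁ 2 (μ.restrict A₁)) :
    codeMeasure μ A₁ (fun n => (x n : G)⁻¹ * y n) f =
      codeMeasure μ A₂ (fun n => (x n : G)⁻¹ * y n) (U f) := by
  have hn : ∀ ξ, ‖U ξ‖ₑ = ‖ξ‖ₑ := fun ξ => by
    rw [← ofReal_norm, ← ofReal_norm, U.norm_map]
  have : IsFiniteMeasure (codeMeasure μ A₁ (fun n => (x n : G)⁻¹ * y n) f) := ⟨by
    rw [codeMeasure_univ hA₁.isClosed.measurableSet]
    exact ENNReal.rpow_lt_top_of_nonneg (by norm_num) enorm_ne_top⟩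
  refine ext_of_generate_finite _ (generateFrom_trueCylinders ι) (isPiSystem_trueCylinders ι) ?_ ?_
  · rintro _ ⟨l, rfl⟩
    rw [codeMeasure_trueCylinder hA₁ x y f l, codeMeasure_trueCylinder hA₂ x y (U f) l, ← hn]
    congr 2
    induction l with
    | nil => rfl
    | cons n l ih =>
      rw [List.foldr_cons, List.foldr_cons, IsometricRep.map_compressedRangeProj hU, ih]
  · rw [codeMeasure_univ hA₁.isClosed.measurableSet, codeMeasure_univ hA₂.isClosed.measurableSet, hn]

end CodeMeasure

/-! ### Topology of `P`-spaces -/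

section Geometry

/-- Such a group is complete in its right uniformity, which is countably generated. Polishness makes
Borel images analytic. -/
theorem polishSpace_of_locallyCompact_secondCountable_group (G : Type*) [Group G]
    [TopologicalSpace G] [IsTopologicalGroup G] [LocallyCompactSpace G] [T2Space G]
    [SecondCountableTopology G] : PolishSpace G := by
  let _ : UniformSpace G := IsTopologicalGroup.rightUniformSpace G
  have : IsRightUniformGroup G := { uniformity_eq := rfl }
  have : CompleteSpace G := IsRightUniformGroup.completeSpace_of_weaklyLocallyCompactSpace
  have : (uniformity G).IsCountablyGenerated := by
    rw [uniformity_eq_comap_nhds_one]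
    infer_instance
  infer_instance

variable {G : Type*} [Group G] [TopologicalSpace G] [IsTopologicalGroup G] {P : Submonoid G}
  {A : Set G}

theorem IsPSpace.mul_mem_interior (hA : IsPSpace P A) {p a : G} (hp : p ∈ interior (P : Set G))
    (ha : a ∈ A) : p * a ∈ interior A := by
  refine mem_interior.2 ⟨(fun g => g * a) '' interior (P : Set G), ?_,
    isOpenMap_mul_right a _ isOpen_interior, ⟨p, hp, rfl⟩⟩
  rintro _ ⟨q, hq, rfl⟩
  exact hA.mul_mem q (interior_subset hq) a ha

/-- The identity is a limit of interior points `p` of `P`, so `a` is a limit of the interior points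
`p * a`. -/
theorem IsPSpace.subset_closure_interior (hA : IsPSpace P A)
    (hdense : (P : Set G) ⊆ closure (interior (P : Set G))) : A ⊆ closure (interior A) := by
  intro a ha
  have h := map_mem_closure (f := fun g => g * a) (continuous_mul_const a) (hdense P.one_mem)
    fun p hp => hA.mul_mem_interior hp ha
  simpa using h

theorem IsPSpace.interior_nonempty (hA : IsPSpace P A)
    (hdense : (P : Set G) ⊆ closure (interior (P : Set G))) : (interior A).Nonempty :=
  closure_nonempty_iff.1 (hA.nonempty.mono (hA.subset_closure_interior hdense))

/-- If a dense set of translates of `A` and `B` cannot tell `(A, a)` from `(B, b)`, no translate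
can. -/
theorem mul_mem_of_dense_translates {A B : Set G} (hA : A ⊆ closure (interior A))
    (hB : IsClosed B) {ι : Type*} {d : ι → G} (hd : DenseRange d) {a b : G}
    (h : ∀ n, (d n)⁻¹ * a ∈ A → (d n)⁻¹ * b ∈ B) {g : G} (hg : g * a ∈ A) : g * b ∈ B := by
  have hO : IsOpen {g : G | g⁻¹ * a ∈ interior A} :=
    isOpen_interior.preimage (continuous_inv.mul_const a)
  have hC : IsClosed {g : G | g⁻¹ * b ∈ B} := hB.preimage (continuous_inv.mul_const b)
  -- The sampled `d n` are dense in the open set on the left, and the set on the right is closed.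
  have hOC : {g : G | g⁻¹ * a ∈ interior A} ⊆ {g : G | g⁻¹ * b ∈ B} := by
    refine (hd.open_subset_closure_inter hO).trans (closure_minimal ?_ hC)
    rintro _ ⟨hg, n, rfl⟩
    exact h n (interior_subset hg)
  -- Approximate `g * a` by `c ∈ interior A` and replace `g` by `c * a⁻¹`.
  have key := map_mem_closure (f := fun c => c * a⁻¹ * b) (t := B) (by fun_prop) (hA hg)
    fun c hc => by
      have := @hOC (c * a⁻¹)⁻¹ (by simpa using hc)
      simpa using this
  rw [hB.closure_eq] at key
  simpa using key

end Geometry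

/-! ### Two points with the same code -/

theorem exists_translateCode_eq {G : Type*} [Group G] [TopologicalSpace G] [IsTopologicalGroup G]
    [LocallyCompactSpace G] [T2Space G] [SecondCountableTopology G]
    [MeasurableSpace G] [BorelSpace G] {μ : Measure G} [μ.IsHaarMeasure] [μ.Regular]
    {P : Submonoid G} {ι : Type*} [Countable ι]
    {K₁ : Type*} [NormedAddCommGroup K₁] [InnerProductSpace ℂ K₁] [CompleteSpace K₁] [Nontrivial K₁]
    {K₂ : Type*} [NormedAddCommGroup K₂] [InnerProductSpace ℂ K₂] [CompleteSpace K₂]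
    {A₁ A₂ : Set G} (hA₁ : IsPSpace P A₁) (hA₂ : IsPSpace P A₂) (hint : (interior A₁).Nonempty)
    (hV : (pSpaceRep μ K₁ hA₁).UnitarilyEquivalent (pSpaceRep μ K₂ hA₂)) (x y : ι → P) :
    ∃ a ∈ A₁, ∃ b ∈ A₂, translateCode A₁ (fun n => (x n : G)⁻¹ * y n) a =
      translateCode A₂ (fun n => (x n : G)⁻¹ * y n) b := by
  obtain ⟨U, hU⟩ := hV
  have := polishSpace_of_locallyCompact_secondCountable_group G
  have hm₁ := hA₁.isClosed.measurableSet
  have hm₂ := hA₂.isClosed.measurableSet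
  set d : ι → G := fun n => (x n : G)⁻¹ * y n with hd
  by_contra! hne
  -- Lusin separation: the images of `A₁` and `A₂` are only known to be analytic.
  obtain ⟨B, hB₁, hB₂, hB⟩ := (hm₁.analyticSet_image
    (measurable_translateCode hm₁ d)).measurablySeparable
    (hm₂.analyticSet_image (measurable_translateCode hm₂ d)) (by
      rw [Set.disjoint_left]
      rintro _ ⟨a, ha, rfl⟩ ⟨b, hb, hab⟩
      exact hne a ha b hb hab.symm)
  -- `B` carries all the mass `‖f‖²` of the first law and none of the second, yet the laws coincide.
  have hzero : ∀ f : Lp K₁ 2 (μ.restrict A₁), f = 0 := by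
    intro f
    have h₁ : codeMeasure μ A₁ d f B = ‖f‖ₑ ^ (2 : ℝ) := by
      rw [codeMeasure_apply hm₁ d f hB, ← lintegral_enorm_rpow_two]
      refine setLIntegral_congr_fun hm₁ fun z hz => ?_
      have : z ∈ translateCode A₁ d ⁻¹' B := hB₁ ⟨z, hz, rfl⟩
      simp only [Set.indicator_of_mem this]
    have h₂ : codeMeasure μ A₂ d (U f) B = 0 := by
      rw [codeMeasure_apply hm₂ d (U f) hB,
        setLIntegral_congr_fun (g := fun _ => 0) hm₂ fun z hz => ?_, lintegral_zero]
      have : z ∉ translateCode A₂ d ⁻¹' B :=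
        fun h => Set.disjoint_left.1 hB₂ ⟨z, hz, rfl⟩ h
      simp [Set.indicator_of_notMem this]
    rw [codeMeasure_map_eq hA₁ hA₂ U hU, h₂] at h₁
    simpa using h₁.symm
  -- A nonzero vector: `v` times the indicator of a compact set with nonempty interior inside `A₁`.
  obtain ⟨v, hv⟩ := exists_ne (0 : K₁)
  obtain ⟨a, ha⟩ := hint
  obtain ⟨C, hC, haC, hCA⟩ := exists_compact_subset isOpen_interior ha
  have hCfin : μ.restrict A₁ C ≠ ⊤ :=
    ((Measure.restrict_apply_le _ _).trans_lt hC.measure_lt_top).ne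
  have hC0 : μ.restrict A₁ C ≠ 0 := by
    rw [Measure.restrict_eq_self _ (hCA.trans interior_subset)]
    exact (Measure.measure_pos_of_mem_nhds μ (mem_interior_iff_mem_nhds.1 haC)).ne'
  have hf := hzero (indicatorConstLp 2 hC.measurableSet hCfin v)
  have := congrArg norm hf
  rw [norm_indicatorConstLp (by simp) (by simp), norm_zero] at this
  simp [hv, Measure.real, ENNReal.toReal_eq_zero_iff, hC0, hCfin] at this

end Auxiliary

theorem mainTheorem9
    {E : Type*} [NormedAddCommGroup E] [NormedSpace ℝ E] [FiniteDimensional ℝ E]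
    {G : Type*} [Group G] [TopologicalSpace G] [ChartedSpace E G] [LieGroup 𝓘(ℝ, E) ∞ G]
    [IsTopologicalGroup G] [LocallyCompactSpace G] [T2Space G]
    [SecondCountableTopology G] [ConnectedSpace G]
    [MeasurableSpace G] [BorelSpace G]
    (μ : Measure G) [μ.IsHaarMeasure] [μ.Regular]
    (P : Submonoid G) (hP : IsLieSemigroup E P)
    (hdense : (P : Set G) ⊆ closure (interior (P : Set G)))
    (hOre₁ : (P : Set G) * (P : Set G)⁻¹ = Set.univ)
    (hOre₂ : (P : Set G)⁻¹ * (P : Set G) = Set.univ)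
    (K₁ : Type*) [NormedAddCommGroup K₁] [InnerProductSpace ℂ K₁] [CompleteSpace K₁]
    [TopologicalSpace.SeparableSpace K₁] [Nontrivial K₁]
    (K₂ : Type*) [NormedAddCommGroup K₂] [InnerProductSpace ℂ K₂] [CompleteSpace K₂]
    [TopologicalSpace.SeparableSpace K₂] [Nontrivial K₂]
    (A₁ A₂ : Set G) (hA₁ : IsPSpace P A₁) (hA₂ : IsPSpace P A₂)
    (hV : (pSpaceRep μ K₁ hA₁).UnitarilyEquivalent (pSpaceRep μ K₂ hA₂)) :
    ∃ z : G, A₂ = (fun a => a * z) '' A₁ := by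
  have hex : ∀ g : G, ∃ x y : P, (x : G)⁻¹ * y = g := fun g => by
    obtain ⟨p, hp, q, hq, h⟩ := hOre₂ ▸ Set.mem_univ g
    exact ⟨⟨p⁻¹, hp⟩, ⟨q, hq⟩, by simpa using h⟩
  choose x y hxy using fun n : ℕ => hex (TopologicalSpace.denseSeq G n)
  have hd : DenseRange fun n => (x n : G)⁻¹ * y n := by
    simpa only [hxy] using TopologicalSpace.denseRange_denseSeq G
  obtain ⟨a, -, b, -, hab⟩ :=
    exists_translateCode_eq hA₁ hA₂ (hA₁.interior_nonempty hdense) hV x y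
  have hiff : ∀ n, ((x n : G)⁻¹ * y n)⁻¹ * a ∈ A₁ ↔ ((x n : G)⁻¹ * y n)⁻¹ * b ∈ A₂ := fun n => by
    rw [← translateCode_eq_true_iff (d := fun n => (x n : G)⁻¹ * y n), hab,
      translateCode_eq_true_iff]
  -- Comparing `g a ∈ A₁` with `g b ∈ A₂` at `g = c b⁻¹` sends `c ∈ A₂` to `c b⁻¹ a ∈ A₁`.
  refine ⟨a⁻¹ * b, Set.ext fun c => ⟨fun hc => ?_, ?_⟩⟩
  · refine ⟨c * b⁻¹ * a, ?_, by group⟩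
    exact mul_mem_of_dense_translates (hA₂.subset_closure_interior hdense) hA₁.isClosed hd
      (fun n => (hiff n).2) (by simpa using hc)
  · rintro ⟨c, hc, rfl⟩
    have := mul_mem_of_dense_translates (hA₁.subset_closure_interior hdense) hA₂.isClosed hd
      (fun n => (hiff n).1) (g := c * a⁻¹) (by simpa using hc)
    simpa [mul_assoc] using this
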